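/- **HITS.** On a finite directed graph with nodes $v_1,\dots,v_N$, HITS starts with all authority scores $a_i^{(0)}$ and hub scores $h_i^{(0)}$ equal to $1$ and, in iteration $t=1,2,\dots$, sets $a_i^{(t)}=\sum_{v_j\to v_i}h_j^{(t-1)}$ and then $h_i^{(t)}=\sum_{v_i\to v_j}a_j^{(t)}$, each vector being rescaled to Euclidean norm $1$. An undirected edge counts as a pair of opposite directed edges. **Convergence in rank.** Let $x^0,x^1,\dots$ be a sequence of score vectors and let $T_k^t=\{v_i : |\{v_j : x^t_j>x^t_i\}|<k\}$ be the set of weakly top $k$ nodes at step $t$. The sequence *converges on $h$ of the top $k$ ranks in $\tau$ steps* if $|\bigcap_{t\ge\tau}T_k^t|\ge h$. **The graph $\Gamma_{h,k,n}$.** Let $m=h-3$ and $\ell=\lceil\frac{k-h+1}{h-3}\rceil$. Let $\bar\Gamma_{m,n}$ be the graph with vertices $v_{-n},\dots,v_{n+m}$ in which $v_{-n},\dots,v_n$ form a path in this order and both ends $v_{-n}$ and $v_n$ are also joined to each of $v_{n+1},\dots,v_{n+m}$. Then $\Gamma_{h,k,n}$ is the disjoint union of $\bar\Gamma_{m,n}$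 and $\ell$ copies of $\bar\Gamma_{m,n}-v_0$. **Theorem.** Call integers $h,k,n$ admissible if $k>h>5$, $n$ is odd and $n\ge\max(3,\frac{k-h+2}{2})$. Put $N=\lceil\frac{k-2}{h-3}\rceil(2n+h-3)+1$ and $\bar t=\frac{3\ln(7/6)}{4e}\left(\frac{h-3}{2}\right)^{(n-1)/2}$. 1. For all admissible $h,k,n$ the undirected graph $\Gamma_{h,k,n}$ has exactly $N$ vertices, and on it HITS needs more than $\bar t$ steps to converge on $h$ of the top $k$ ranks: for no integer $0\le\tau\le\bar t$ does it converge on $h$ of the top $k$ ranks in $\tau$ steps. This holds for the sequence $(a^{(t)})_{t\ge0}$ of authority vectors, for the sequence $(h^{(t)})_{t\ge0}$ of hub vectors, and for the sequence $h^{(0)},a^{(1)},h^{(1)},a^{(2)},h^{(2)},\dots$ in which each half iteration counts as a step. 2. $\bar t=h^{\Omega(n)}$: there are absolute constants $c>0$ and $n_0$ such that $\bar t\ge h^{cn}$ for all admissible $h,k,n$ with $n\ge n_0$. 3. $\bar t=h^{\Omega(Nh/k)}$ for $N\ge 2k$, in the following two senses. (a) There is an absolute constant $c>0$ such that for all $h,k$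 there is an $N_0$ with $\bar t\ge h^{cNh/k}$ for all $n$ such that $h,k,n$ are admissible, $N\ge 2k$ and $N\ge N_0$. (b) For every $\varepsilon>0$ there are $c>0$ and $n_0$, depending only on $\varepsilon$, such that $\bar t\ge h^{cNh/k}$ for all admissible $h,k,n$ with $n\ge n_0$, $N\ge 2k$, and $k\ge(1+\varepsilon)h$ or $N\ge(2+\varepsilon)k$. -/

import Mathlib

namespace HITS

section Algorithm

variable {V : Type*} [Fintype V]

/-- Rescaling of a score vector to Euclidean norm one. -/
noncomputable def normalize (x : V → ℝ) : V → ℝ :=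
  ‖WithLp.toLp 2 x‖⁻¹ • x

open Classical in
/-- The pair (authority scores, hub scores) after `t` iterations of HITS on the directed graph
whose edges are the pairs `v → u` with `R v u`. All scores are initially `1`; an iteration
recomputes the authority scores from the hub scores, then the hub scores from the new
authority scores, and normalizes both. -/
noncomputable def scores (R : V → V → Prop) : ℕ → (V → ℝ) × (V → ℝ)
  | 0 => (fun _ => 1, fun _ => 1)
  | t + 1 =>
    let a := normalize (fun i => ∑ j with R j i, (scores R t).2 j)
    (a, normalize (fun i => ∑ j with R i j, a j))

/-- The authority vector after `t` iterations. -/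
noncomputable def authority (R : V → V → Prop) (t : ℕ) : V → ℝ := (scores R t).1

/-- The hub vector after `t` iterations. -/
noncomputable def hub (R : V → V → Prop) (t : ℕ) : V → ℝ := (scores R t).2

/-- The vectors computed by HITS in the order in which they are computed (half an iteration per
step): at time `2 s` the hub vector of iteration `s`, at time `2 s - 1` the authority vector of
iteration `s`. -/
noncomputable def halfSteps (R : V → V → Prop) (t : ℕ) : V → ℝ :=
  if Even t then hub R (t / 2) else authority R ((t + 1) / 2)

/-- The (weakly) top `k` nodes for the scores `x`: those with fewer than `k` nodes of strictly
larger score. -/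
def top (k : ℕ) (x : V → ℝ) : Set V := {i | {j | x i < x j}.ncard < k}

/-- The sequence `x` of score vectors converges on `h` of the top `k` ranks in `τ` steps. -/
def ConvergesIn (x : ℕ → V → ℝ) (h k τ : ℕ) : Prop :=
  h ≤ (⋂ t ≥ τ, top k (x t)).ncard

end Algorithm

section Graph

/-- The number `ℓ` of copies of the component without a middle vertex. -/
noncomputable def copies (h k : ℕ) : ℕ := ⌈((k : ℝ) - h + 1) / ((h : ℝ) - 3)⌉₊

/-- Vertices of `Γ_{h,k,n}`, with `m = h - 3`: the pair `(c, i)` is the vertex of index `i` in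
component `c`, where `-n ≤ i ≤ n + m` and `0 ≤ c ≤ ℓ`; only component `0` has a vertex of
index `0`. -/
noncomputable def gammaVertices (h k n : ℕ) : Finset (ℕ × ℤ) :=
  (Finset.range (copies h k + 1) ×ˢ Finset.Icc (-(n : ℤ)) ((n : ℤ) + ((h : ℤ) - 3))).filter
    fun p => p.2 = 0 → p.1 = 0

/-- Adjacency of indices inside a component: `-n, …, n` form a chain, and both ends `-n` and `n`
of the chain are joined to all indices above `n`. -/
def indexAdj (n : ℕ) (i j : ℤ) : Prop :=
  (|i| ≤ n ∧ |j| ≤ n ∧ |i - j| = 1) ∨ (|i| = n ∧ (n : ℤ) < j) ∨ (|j| = n ∧ (n : ℤ) < i)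

/-- The undirected graph `Γ_{h,k,n}`. -/
def Gamma (h k n : ℕ) : SimpleGraph (gammaVertices h k n) where
  Adj p q := p.1.1 = q.1.1 ∧ indexAdj n p.1.2 q.1.2
  symm := ⟨by
    rintro p q ⟨h₁, h₂⟩
    refine ⟨h₁.symm, ?_⟩
    rcases h₂ with ⟨a, b, c⟩ | h₂ | h₂
    · exact Or.inl ⟨b, a, by rwa [abs_sub_comm]⟩
    · exact Or.inr (Or.inr h₂)
    · exact Or.inr (Or.inl h₂)⟩
  loopless := ⟨by
    rintro p ⟨-, ⟨-, -, c⟩ | ⟨a, b⟩ | ⟨a, b⟩⟩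
    · simp at c
    · have := le_abs_self p.1.2
      omega
    · have := le_abs_self p.1.2
      omega⟩

end Graph

/-- The admissible parameters. -/
def Admissible (h k n : ℕ) : Prop :=
  5 < h ∧ h < k ∧ Odd n ∧ max 3 (((k : ℝ) - h + 2) / 2) ≤ n

/-- `N = ⌈(k-2)/(h-3)⌉ (2n+h-3) + 1`. -/
noncomputable def numVertices (h k n : ℕ) : ℕ :=
  ⌈((k : ℝ) - 2) / ((h : ℝ) - 3)⌉₊ * (2 * n + h - 3) + 1

/-- `3 ln(7/6) / (4e) * ((h-3)/2)^((n-1)/2)`. -/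
noncomputable def tBar (h n : ℕ) : ℝ :=
  3 * Real.log (7 / 6) / (4 * Real.exp 1) * (((h : ℝ) - 3) / 2) ^ (((n : ℝ) - 1) / 2)

end HITS

/-!
As the adjacency matrix `A` of `Γ` is symmetric, every score vector is a positive multiple of
`A ^ s 1` for some `s`, that is, of the vector of numbers of walks of length `s`.

Walks in the component containing `v₀` dominate those in the other components by an exponentially
growing factor, so in the long run only vertices of this component, which has at least `k` vertices,
are among the top `k`. On the other hand, the influence of `v₀` on the walk counts is damped by a
factor `2 / m` for every two edges of the chain. Hence for about `(m / 2) ^ ((n - 1) / 2)`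
iterations the ends of the chains have almost the same walk counts in all components. During this
time the two ends of the chain through `v₀` and all vertices of index above `n`, at least `k` in
total, beat the inner vertices of that chain. This leaves only the `2 + m = h - 1` vertices of the
component of `v₀` that are not inner vertices of its chain as permanent members of the top `k`.
-/

namespace HITS

section Walks

variable {V : Type*} [Fintype V] {R : V → V → Prop}

open Classical in
/-- The adjacency operator of `R`: each vertex receives the sum of the values of its
out-neighbours. -/
noncomputable def nbrSum (R : V → V → Prop) (x : V → ℝ) : V → ℝ := fun i => ∑ j with R i j, x j

/-- The number of walks of length `s` starting in a given vertex. -/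
noncomputable def walks (R : V → V → Prop) (s : ℕ) : V → ℝ := (nbrSum R)^[s] 1

lemma nbrSum_smul (c : ℝ) (x : V → ℝ) : nbrSum R (c • x) = c • nbrSum R x := by
  ext i
  simp only [nbrSum, Pi.smul_apply, smul_eq_mul, Finset.mul_sum]

lemma walks_succ (s : ℕ) : walks R (s + 1) = nbrSum R (walks R s) :=
  Function.iterate_succ_apply' _ _ _

-- For `x = 0` the junk value `0⁻¹ = 0` does no harm, since every multiple of `x` is `0`.
lemma exists_normalize_eq_smul (x : V → ℝ) : ∃ c : ℝ, 0 < c ∧ normalize x = c • x := by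
  rcases eq_or_ne x 0 with rfl | hx
  · exact ⟨1, one_pos, by simp [normalize]⟩
  · exact ⟨‖WithLp.toLp 2 x‖⁻¹, inv_pos.2 (norm_pos_iff.2 fun h => hx (by simpa using h)), rfl⟩

lemma halfSteps_two_mul (t : ℕ) : halfSteps R (2 * t) = hub R t := by simp [halfSteps]

lemma halfSteps_two_mul_add_one (t : ℕ) : halfSteps R (2 * t + 1) = authority R (t + 1) := by
  simp [halfSteps, show (2 * t + 1 + 1) / 2 = t + 1 by lia]

open Classical in
lemma halfSteps_succ [Std.Symm R] (t : ℕ) :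
    halfSteps R (t + 1) = normalize (nbrSum R (halfSteps R t)) := by
  obtain ⟨s, rfl | rfl⟩ := Nat.even_or_odd' t
  · rw [halfSteps_two_mul_add_one, halfSteps_two_mul]
    refine congrArg normalize (funext fun i => ?_)
    exact Finset.sum_congr (Finset.filter_congr fun j _ => comm) fun _ _ => rfl
  · rw [show 2 * s + 1 + 1 = 2 * (s + 1) by ring, halfSteps_two_mul, halfSteps_two_mul_add_one]
    rfl

lemma exists_halfSteps_eq_smul_walks [Std.Symm R] (t : ℕ) :
    ∃ c : ℝ, 0 < c ∧ halfSteps R t = c • walks R t := by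
  induction t with
  | zero => exact ⟨1, one_pos, by simp [halfSteps, hub, scores, walks]; rfl⟩
  | succ t ih =>
    obtain ⟨c, hc, ht⟩ := ih
    obtain ⟨d, hd, hnorm⟩ := exists_normalize_eq_smul (nbrSum R (halfSteps R t))
    exact ⟨d * c, mul_pos hd hc, by
      rw [halfSteps_succ, hnorm, ht, nbrSum_smul, smul_smul, walks_succ]⟩

lemma exists_hub_eq_smul_walks [Std.Symm R] (t : ℕ) :
    ∃ c : ℝ, 0 < c ∧ hub R t = c • walks R (2 * t) := by
  simpa only [halfSteps_two_mul] using exists_halfSteps_eq_smul_walks (2 * t)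

-- The truncated `2 * 0 - 1 = 0` is the right length at time `0`, where all scores are `1`.
lemma exists_authority_eq_smul_walks [Std.Symm R] (t : ℕ) :
    ∃ c : ℝ, 0 < c ∧ authority R t = c • walks R (2 * t - 1) := by
  rcases t with _ | t
  · exact ⟨1, one_pos, by simp [authority, scores, walks]; rfl⟩
  · rw [← halfSteps_two_mul_add_one]
    exact exists_halfSteps_eq_smul_walks (2 * t + 1)

end Walks

section Top

variable {V : Type*} {α : Type*} {G : Finset α} {k : ℕ}

lemma top_smul {c : ℝ} (hc : 0 < c) (k : ℕ) (x : V → ℝ) :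
    top k (c • x) = top k x := by
  simp only [top, Pi.smul_apply, smul_eq_mul, mul_lt_mul_iff_right₀ hc]

lemma notMem_top {x : G → ℝ} {p : G} {T : Finset α} (hk : k ≤ T.card)
    (hT : ∀ a ∈ T, ∃ ha : a ∈ G, x p < x ⟨a, ha⟩) : p ∉ top k x := by
  refine not_lt.2 (hk.trans ?_)
  rw [← Set.ncard_coe_finset, ← Set.ncard_image_of_injective _ Subtype.val_injective]
  refine Set.ncard_le_ncard (fun a ha => ?_) (Set.toFinite _)
  obtain ⟨haG, hlt⟩ := hT a ha
  exact ⟨⟨a, haG⟩, hlt, rfl⟩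

lemma ncard_le_card_of_forall_mem {S : Set G} {T : Finset α} (hS : ∀ p ∈ S, p.1 ∈ T) :
    S.ncard ≤ T.card := by
  rw [← Set.ncard_coe_finset, ← Set.ncard_image_of_injective S Subtype.val_injective]
  exact Set.ncard_le_ncard (Set.image_subset_iff.2 hS) (Set.toFinite _)

end Top

section Profile

/-- One step of walk counting on a component of `Γ`, for values that depend only on the distance
`j` from the middle: `j ≤ n` stands for the vertices of index `±j`, and `j = n + 1` for the `m`
vertices of index above `n`. -/
def step (m n : ℕ) (x : ℕ → ℝ) (j : ℕ) : ℝ :=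
  if j = 0 then 2 * x 1
  else if j = n + 1 then 2 * x n
  else x (j - 1) + (if j = n then (m : ℝ) else 1) * x (j + 1)

/-- The number of walks of length `s` starting at distance `j` from the middle of a component of
`Γ`, with `j` encoded as in `step`. The weight `b` of the middle vertex is `1` if this vertex is
present and `0` if it is not; in the latter case the value at `j = 0` is `0`. -/
def profile (m n : ℕ) (b : ℝ) : ℕ → ℕ → ℝ
  | 0, j => if j = 0 then b else 1
  | s + 1, j => (if j = 0 then b else 1) * step m n (profile m n b s) j

variable {m n : ℕ} {b : ℝ} {s j : ℕ}

lemma step_nonneg {x : ℕ → ℝ} (hx : ∀ j, 0 ≤ x j) (j : ℕ) : 0 ≤ step m n x j := by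
  have h1 := hx 1
  have hn := hx n
  have hpred := hx (j - 1)
  have hsucc := hx (j + 1)
  rw [step]
  split_ifs <;> positivity

lemma step_le_mul {x y : ℕ → ℝ} {c : ℝ} (h : ∀ j ≤ n + 1, x j ≤ c * y j) (hj : j ≤ n + 1) :
    step m n x j ≤ c * step m n y j := by
  have h1 := h 1 (by lia)
  have hn := h n (by lia)
  have hpred := h (j - 1) (by lia)
  rw [step, step]
  split_ifs with h0 htop hend
  · linarith
  · linarith
  · linarith [mul_le_mul_of_nonneg_left (h (j + 1) (by lia)) m.cast_nonneg]
  · linarith [h (j + 1) (by lia)]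

lemma profile_one_succ : profile m n 1 (s + 1) j = step m n (profile m n 1 s) j := by
  simp [profile]

lemma profile_one_zero : profile m n 1 0 j = 1 := by simp [profile]

lemma profile_zero_succ : profile m n b 0 (j + 1) = 1 := by simp [profile]

lemma profile_zero_zero_apply_zero : profile m n 0 s 0 = 0 := by
  cases s <;> simp [profile]

lemma profile_succ_zero : profile m n b (s + 1) 0 = 2 * b * profile m n b s 1 := by
  simp only [profile, step, if_true]
  ring

lemma profile_succ_inner (hj : j + 1 < n) :
    profile m n b (s + 1) (j + 1) = profile m n b s j + profile m n b s (j + 2) := by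
  simp [profile, step, show j ≠ n by lia, show j + 1 ≠ n by lia]

lemma profile_succ_end :
    profile m (n + 1) b (s + 1) (n + 1) =
      profile m (n + 1) b s n + m * profile m (n + 1) b s (n + 2) := by
  simp [profile, step]

lemma profile_succ_top : profile m n b (s + 1) (n + 1) = 2 * profile m n b s n := by
  simp [profile, step]

lemma profile_nonneg (hb : 0 ≤ b) (s j : ℕ) : 0 ≤ profile m n b s j := by
  induction s generalizing j with
  | zero => rw [profile]; positivity
  | succ s ih => rw [profile]; exact mul_nonneg (by positivity) (step_nonneg ih j)

end Profile

section TwoSteps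

variable {m n : ℕ} {b : ℝ} {s : ℕ}

lemma profile_two_end :
    profile m (n + 2) b (s + 2) (n + 2) =
      (2 * m) * profile m (n + 2) b s (n + 2) + profile m (n + 2) b (s + 1) (n + 1) := by
  rw [profile_succ_end, profile_succ_top]
  ring

lemma profile_two_inner {l : ℕ} (hl : l + 4 ≤ n) :
    profile m n b (s + 2) (l + 2) =
      profile m n b s l + 2 * profile m n b s (l + 2) + profile m n b s (l + 4) := by
  rw [profile_succ_inner (by lia), profile_succ_inner (by lia), profile_succ_inner (by lia)]
  ring

lemma profile_two_one (hn : 3 ≤ n) :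
    profile m n b (s + 2) 1 = (1 + 2 * b) * profile m n b s 1 + profile m n b s 3 := by
  rw [profile_succ_inner (j := 0) (by lia), profile_succ_zero, profile_succ_inner (by lia)]
  ring

end TwoSteps

section WholeComponent

variable {m n s j : ℕ}

lemma two_mul_profile_le (hm : 1 ≤ m) (hj : j ≤ n + 1) :
    2 * profile m n 1 s j ≤ profile m n 1 (s + 1) j := by
  induction s generalizing j with
  | zero =>
    have hm' : (1 : ℝ) ≤ m := by exact_mod_cast hm
    simp only [profile_one_succ, profile_one_zero, step]
    split_ifs <;> linarith
  | succ s ih =>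
    have hstep := step_le_mul (m := m) (c := 1 / 2)
      (fun i hi => show profile m n 1 s i ≤ 1 / 2 * profile m n 1 (s + 1) i by linarith [ih hi]) hj
    rw [← profile_one_succ, ← profile_one_succ] at hstep
    linarith

lemma profile_le_end (hm : 1 ≤ m) (hj : j ≤ n + 2) :
    profile m (n + 1) 1 s j ≤ profile m (n + 1) 1 s (n + 1) := by
  induction s generalizing j with
  | zero => simp only [profile_one_zero, le_refl]
  | succ s ih =>
    rcases eq_or_ne j (n + 1) with rfl | hne
    · exact le_rfl
    refine le_trans ?_ (two_mul_profile_le hm (by lia))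
    rcases hj.eq_or_lt with rfl | hlt
    · exact profile_succ_top.le
    rcases j with _ | j
    · linarith [profile_succ_zero (m := m) (n := n + 1) (b := 1) (s := s), ih (j := 1) (by lia)]
    · linarith [profile_succ_inner (m := m) (b := 1) (s := s) (show j + 1 < n + 1 by lia),
        ih (j := j) (by lia), ih (j := j + 2) (by lia)]

lemma profile_two_le (hm : 1 ≤ m) :
    profile m (n + 2) 1 (s + 2) n ≤
      3 * profile m (n + 2) 1 s (n + 2) + profile m (n + 2) 1 s n := by
  have hle : ∀ i ≤ n + 2, profile m (n + 2) 1 s i ≤ profile m (n + 2) 1 s (n + 2) :=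
    fun i hi => profile_le_end hm (by lia)
  rcases n with _ | _ | n
  · rw [profile_succ_zero, profile_succ_inner (by lia)]
    linarith [hle 0 (by lia)]
  · rw [profile_two_one le_rfl]
    linarith [hle 1 (by lia)]
  · rw [profile_two_inner le_rfl]
    linarith [hle n (by lia), hle (n + 2) (by lia)]

lemma two_mul_profile_le_end (hm : 3 ≤ m) :
    2 * profile m (n + 2) 1 (s + 1) n ≤ profile m (n + 2) 1 (s + 1) (n + 2) := by
  have hm' : (3 : ℝ) ≤ m := by exact_mod_cast hm
  rcases s with _ | s
  · rw [profile_succ_end]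
    rcases n with _ | n
    · simp only [profile_succ_zero, profile_one_zero]
      linarith
    · rw [profile_succ_inner (by lia)]
      simp only [profile_one_zero]
      linarith
  · have hend : 0 ≤ profile m (n + 2) 1 s (n + 2) := profile_nonneg zero_le_one _ _
    rw [profile_two_end, profile_succ_inner (by lia)]
    linarith [mul_le_mul_of_nonneg_right hm' hend,
      profile_two_le (n := n) (s := s) (show 1 ≤ m by lia),
      profile_le_end (m := m) (n := n + 1) (s := s) (j := n) (by lia) (by lia)]

lemma two_mul_profile_succ_le (hm : 3 ≤ m) (hj : j ≤ n + 1)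
    (hs : ∀ i ≤ n + 1,
      4 * profile m (n + 2) 1 (s + 1) i ≤ 3 * profile m (n + 2) 1 (s + 1) (n + 2)) :
    2 * profile m (n + 2) 1 (s + 2) j ≤ 3 * profile m (n + 2) 1 (s + 1) (n + 2) := by
  rcases j with _ | j
  · rw [profile_succ_zero]
    linarith [hs 1 (by lia)]
  · rw [profile_succ_inner (by lia)]
    rcases hj.eq_or_lt with hj | hj
    · obtain rfl : j = n := by lia
      linarith [two_mul_profile_le_end (n := j) (s := s) hm]
    · linarith [hs j (by lia), hs (j + 2) (by lia)]

lemma four_mul_profile_le (hm : 3 ≤ m) (hj : j ≤ n + 1) :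
    4 * profile m (n + 2) 1 (s + 1) j ≤ 3 * profile m (n + 2) 1 (s + 1) (n + 2) := by
  induction s generalizing j with
  | zero =>
    have hm' : (3 : ℝ) ≤ m := by exact_mod_cast hm
    rw [profile_succ_end]
    rcases j with _ | j
    · simp only [profile_succ_zero, profile_one_zero]
      linarith
    · rw [profile_succ_inner (by lia)]
      simp only [profile_one_zero]
      linarith
  | succ s ih =>
    linarith [two_mul_profile_succ_le hm hj fun _ => ih,
      two_mul_profile_le (m := m) (n := n + 2) (s := s + 1) (j := n + 2) (by lia) (by lia)]

end WholeComponent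

section Comparison

variable {m r s : ℕ} {b P : ℝ}

/-- The walk counts of the component with a middle vertex exceed those of a component without one
by a factor of at most `P` at the ends `±(2 r + 3)` of the chain, and at odd distances from the
middle by an additional amount that decays geometrically away from the middle. Only odd distances
occur because walk counts are compared two steps at a time. -/
def IsClose (m r s : ℕ) (P : ℝ) : Prop :=
  profile m (2 * r + 3) 1 s (2 * r + 3) ≤ P * profile m (2 * r + 3) 0 s (2 * r + 3) ∧
    ∀ l ≤ r, profile m (2 * r + 3) 1 s (2 * l + 1) ≤
      P * (profile m (2 * r + 3) 0 s (2 * l + 1) +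
        (2 / m) ^ l * profile m (2 * r + 3) 0 s (2 * r + 3))

lemma profile_two_end_odd :
    profile m (2 * r + 3) b (s + 2) (2 * r + 3) =
      (2 * m + 1) * profile m (2 * r + 3) b s (2 * r + 3) +
        profile m (2 * r + 3) b s (2 * r + 1) := by
  rw [profile_two_end, profile_succ_inner (by lia)]
  ring

lemma mul_profile_end_le (hb : 0 ≤ b) :
    (2 * m + 1) * profile m (2 * r + 3) b s (2 * r + 3) ≤
      profile m (2 * r + 3) b (s + 2) (2 * r + 3) := by
  rw [profile_two_end_odd]
  exact le_add_of_nonneg_right (profile_nonneg hb _ _)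

lemma profile_end_pos : 0 < profile m (2 * r + 3) 0 s (2 * r + 3) := by
  induction s using Nat.twoStepInduction with
  | zero => simp only [profile_zero_succ, one_pos]
  | one =>
    rw [profile_succ_end, profile_zero_succ, profile_zero_succ]
    positivity
  | more s ih _ => exact (mul_pos (by positivity) ih).trans_le (mul_profile_end_le le_rfl)

lemma isClose_zero : IsClose m r 0 1 := by
  simp only [IsClose, profile_zero_succ, one_mul, le_add_iff_nonneg_right, le_refl, true_and]
  intro l _
  positivity

lemma isClose_one : IsClose m r 1 1 := by
  simp only [IsClose, profile_succ_end, profile_zero_succ, one_mul, le_refl, true_and]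
  rintro (_ | l) hl
  · rw [profile_succ_inner (by lia), profile_succ_inner (by lia), profile_one_zero,
      profile_zero_succ, profile_zero_zero_apply_zero, profile_zero_succ, pow_zero]
    linarith [m.cast_nonneg (α := ℝ)]
  · rw [Nat.mul_succ, profile_succ_inner (by lia), profile_succ_inner (by lia)]
    simp only [profile_zero_succ]
    exact le_add_of_nonneg_right (by positivity)

lemma IsClose.le (hP : 0 ≤ P) (h : IsClose m r s P) {l : ℕ} (hl : l ≤ r + 1) :
    profile m (2 * r + 3) 1 s (2 * l + 1) ≤
      P * (profile m (2 * r + 3) 0 s (2 * l + 1) +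
        (2 / m) ^ l * profile m (2 * r + 3) 0 s (2 * r + 3)) := by
  rcases hl.eq_or_lt with rfl | hlt
  · refine h.1.trans (mul_le_mul_of_nonneg_left (le_add_of_nonneg_right ?_) hP)
    exact mul_nonneg (by positivity) profile_end_pos.le
  · exact h.2 l (by lia)

lemma IsClose.two_end (h : IsClose m r s P) :
    profile m (2 * r + 3) 1 (s + 2) (2 * r + 3) ≤
      P * (profile m (2 * r + 3) 0 (s + 2) (2 * r + 3) +
        (2 / m) ^ r * profile m (2 * r + 3) 0 s (2 * r + 3)) := by
  rw [profile_two_end_odd, profile_two_end_odd]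
  linarith [mul_le_mul_of_nonneg_left h.1 (show (0 : ℝ) ≤ 2 * m + 1 by positivity), h.2 r le_rfl]

lemma IsClose.two_one (hm : 3 ≤ m) (hP : 0 ≤ P) (h : IsClose m r s P) :
    profile m (2 * r + 3) 1 (s + 2) 1 ≤
      P * (profile m (2 * r + 3) 0 (s + 2) 1 + profile m (2 * r + 3) 0 (s + 2) (2 * r + 3)) := by
  set E := profile m (2 * r + 3) 0 s (2 * r + 3)
  have hm' : (3 : ℝ) ≤ m := by exact_mod_cast hm
  have hκ : 2 / (m : ℝ) ≤ 1 := (div_le_one (by linarith)).2 (by linarith)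
  have h1 := h.le hP (l := 0) (by lia)
  have h3 := h.le hP (l := 1) (by lia)
  have hend : profile m (2 * r + 3) 1 s 1 ≤ P * E :=
    (profile_le_end (by lia) (by lia)).trans h.1
  have hE : (3 + 2 / (m : ℝ)) * E ≤ profile m (2 * r + 3) 0 (s + 2) (2 * r + 3) :=
    (mul_le_mul_of_nonneg_right (by linarith) profile_end_pos.le).trans (mul_profile_end_le le_rfl)
  rw [profile_two_one (by lia), profile_two_one (by lia)]
  linarith [mul_le_mul_of_nonneg_left hE hP]

lemma IsClose.two_inner (hm : 3 ≤ m) (hP : 0 ≤ P) (h : IsClose m r s P) {l : ℕ} (hl : l + 1 ≤ r) :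
    profile m (2 * r + 3) 1 (s + 2) (2 * l + 3) ≤
      P * (profile m (2 * r + 3) 0 (s + 2) (2 * l + 3) +
        (2 / m) ^ (l + 1) * profile m (2 * r + 3) 0 (s + 2) (2 * r + 3)) := by
  set κ : ℝ := 2 / m
  set E := profile m (2 * r + 3) 0 s (2 * r + 3)
  have hm' : (3 : ℝ) ≤ m := by exact_mod_cast hm
  have hκ1 : κ ≤ 1 := (div_le_one (by linarith)).2 (by linarith)
  have hκm : κ * m = 2 := div_mul_cancel₀ _ (by positivity)
  have hκsum : κ ^ l + 2 * κ ^ (l + 1) + κ ^ (l + 2) ≤ κ ^ (l + 1) * (2 * m + 1) :=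
    calc κ ^ l + 2 * κ ^ (l + 1) + κ ^ (l + 2) = κ ^ l * (1 + 2 * κ + κ ^ 2) := by ring
      _ ≤ κ ^ l * (2 * (κ * m) + κ) := by gcongr ?_ * ?_; nlinarith [show 0 ≤ κ by positivity]
      _ = κ ^ (l + 1) * (2 * m + 1) := by ring
  have hE : (κ ^ l + 2 * κ ^ (l + 1) + κ ^ (l + 2)) * E ≤
      κ ^ (l + 1) * profile m (2 * r + 3) 0 (s + 2) (2 * r + 3) :=
    calc (κ ^ l + 2 * κ ^ (l + 1) + κ ^ (l + 2)) * E ≤ κ ^ (l + 1) * (2 * m + 1) * E :=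
          mul_le_mul_of_nonneg_right hκsum profile_end_pos.le
      _ = κ ^ (l + 1) * ((2 * m + 1) * E) := mul_assoc _ _ _
      _ ≤ _ := mul_le_mul_of_nonneg_left (mul_profile_end_le le_rfl) (by positivity)
  have htwo (b : ℝ) : profile m (2 * r + 3) b (s + 2) (2 * l + 3) =
      profile m (2 * r + 3) b s (2 * l + 1) + 2 * profile m (2 * r + 3) b s (2 * (l + 1) + 1) +
        profile m (2 * r + 3) b s (2 * (l + 2) + 1) := profile_two_inner (by lia)
  rw [htwo, htwo]
  linarith [h.le hP (l := l) (by lia), h.le hP (l := l + 1) (by lia), h.le hP (l := l + 2) (by lia),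
    mul_le_mul_of_nonneg_left hE hP]

lemma IsClose.step (hm : 3 ≤ m) (hP : 0 ≤ P) (h : IsClose m r s P) :
    IsClose m r (s + 2) ((1 + (2 / m) ^ r / (2 * m + 1)) * P) := by
  set θ : ℝ := (2 / m) ^ r / (2 * m + 1) with hθ
  have hP' : P ≤ (1 + θ) * P := le_mul_of_one_le_left hP (le_add_of_nonneg_right (by positivity))
  refine ⟨h.two_end.trans ?_, fun l hl => ?_⟩
  · have hE : (2 / (m : ℝ)) ^ r * profile m (2 * r + 3) 0 s (2 * r + 3) ≤
        θ * profile m (2 * r + 3) 0 (s + 2) (2 * r + 3) :=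
      calc _ = θ * ((2 * m + 1) * profile m (2 * r + 3) 0 s (2 * r + 3)) := by
            rw [← mul_assoc, hθ, div_mul_cancel₀ _ (by positivity)]
        _ ≤ _ := mul_le_mul_of_nonneg_left (mul_profile_end_le le_rfl) (by positivity)
    linarith [mul_le_mul_of_nonneg_left hE hP]
  · refine le_trans ?_ (mul_le_mul_of_nonneg_right hP' ?_)
    · rcases l with _ | l
      · simpa using h.two_one hm hP
      · exact h.two_inner hm hP hl
    · exact add_nonneg (profile_nonneg le_rfl _ _)
        (mul_nonneg (by positivity) (profile_nonneg le_rfl _ _))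

lemma isClose_pow (hm : 3 ≤ m) : IsClose m r s ((1 + (2 / m) ^ r / (2 * m + 1)) ^ (s / 2)) := by
  induction s using Nat.twoStepInduction with
  | zero => simpa using isClose_zero
  | one => simpa using isClose_one
  | more s ih _ =>
    rw [show (s + 2) / 2 = s / 2 + 1 by lia, pow_succ']
    exact ih.step hm (by positivity)

lemma one_add_pow_lt (hm : 1 ≤ m) {q : ℕ} (hq : (q : ℝ) ≤ (m / 2) ^ (r + 1)) :
    (1 + (2 / m) ^ r / (2 * m + 1)) ^ q < (4 / 3 : ℝ) := by
  have hm' : (0 : ℝ) < m := by exact_mod_cast hm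
  have hexponent : q * ((2 / m) ^ r / (2 * m + 1)) ≤ (1 / 4 : ℝ) :=
    calc (q : ℝ) * ((2 / m) ^ r / (2 * m + 1)) ≤ (m / 2) ^ (r + 1) * ((2 / m) ^ r / (2 * m)) := by
          gcongr; linarith
      _ = (m / 2 * (2 / m)) ^ r * (1 / 4) := by rw [mul_pow]; field_simp; ring
      _ = 1 / 4 := by rw [div_mul_div_cancel₀ two_ne_zero]; simp [hm'.ne']
  calc (1 + (2 / m) ^ r / (2 * m + 1) : ℝ) ^ q
      ≤ Real.exp ((2 / m) ^ r / (2 * m + 1)) ^ q := by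
        gcongr
        rw [add_comm]
        exact Real.add_one_le_exp _
    _ = Real.exp (q * ((2 / m) ^ r / (2 * m + 1))) := (Real.exp_nat_mul _ _).symm
    _ ≤ Real.exp (1 / 4) := Real.exp_le_exp.2 hexponent
    _ < 4 / 3 := by
        refine lt_of_pow_lt_pow_left₀ 4 (by norm_num) ?_
        rw [← Real.exp_nat_mul]
        norm_num
        linarith [Real.exp_one_lt_d9]

lemma profile_end_lt (hm : 3 ≤ m) (hs : ((s / 2 : ℕ) : ℝ) ≤ (m / 2) ^ (r + 1)) :
    profile m (2 * r + 3) 1 s (2 * r + 3) < 4 / 3 * profile m (2 * r + 3) 0 s (2 * r + 3) :=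
  (isClose_pow hm).1.trans_lt
    (mul_lt_mul_of_pos_right (one_add_pow_lt (by lia) hs) profile_end_pos)

end Comparison

section Domination

variable {m n s j : ℕ} {c : ℝ}

lemma le_step_succ {x : ℕ → ℝ} (hx : ∀ i, 0 ≤ x i) (hj : j ≤ n) : x j ≤ step m n x (j + 1) := by
  rw [step, if_neg j.succ_ne_zero, Nat.add_sub_cancel]
  split_ifs with htop hend
  · obtain rfl : j = n := by lia
    linarith [hx j]
  · exact le_add_of_nonneg_right (mul_nonneg m.cast_nonneg (hx _))
  · exact le_add_of_nonneg_right (mul_nonneg zero_le_one (hx _))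

lemma succ_le_step {x : ℕ → ℝ} (hx : ∀ i, 0 ≤ x i) (hm : 1 ≤ m) (hj : j ≤ n) :
    x (j + 1) ≤ step m n x j := by
  have hm' : (1 : ℝ) ≤ m := by exact_mod_cast hm
  rw [step, if_neg (show j ≠ n + 1 by lia)]
  split_ifs with h0 hend
  · subst h0
    linarith [hx 1]
  · exact le_add_of_nonneg_of_le (hx _) (le_mul_of_one_le_left (hx _) hm')
  · exact le_add_of_nonneg_of_le (hx _) (one_mul (x (j + 1))).ge

lemma step_succ_add_le {x y : ℕ → ℝ} (h : ∀ i ≤ n + 1, x i ≤ c * y i) (hj : j ≤ n) :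
    step m n x (j + 1) + (c * y j - x j) ≤ c * step m n y (j + 1) := by
  simp only [step, if_neg j.succ_ne_zero, Nat.add_sub_cancel]
  split_ifs with htop hend
  · obtain rfl : j = n := by lia
    linarith [h j (by lia)]
  · linarith [mul_le_mul_of_nonneg_left (h (j + 1 + 1) (by lia)) m.cast_nonneg]
  · linarith [h (j + 1 + 1) (by lia)]

lemma profile_apply_succ {b : ℝ} :
    profile m n b (s + 1) (j + 1) = step m n (profile m n b s) (j + 1) := by
  simp [profile]

lemma profile_succ_le_mul (hm : 1 ≤ m) (hj : j ≤ n + 1) :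
    profile m n 1 (s + 1) j ≤ (m + 1) * profile m n 1 s j := by
  induction s generalizing j with
  | zero =>
    have hm' : (1 : ℝ) ≤ m := by exact_mod_cast hm
    simp only [profile_one_succ, profile_one_zero, step]
    split_ifs <;> linarith
  | succ s ih =>
    have hstep := step_le_mul (m := m) (fun _ => ih) hj
    rwa [← profile_one_succ, ← profile_one_succ] at hstep

lemma profile_le_mul_succ (hm : 1 ≤ m) (hj : j ≤ n) :
    profile m n 1 s j ≤ (m + 1) * profile m n 1 s (j + 1) :=
  (le_step_succ (profile_nonneg zero_le_one s) hj).trans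
    (profile_one_succ.symm.trans_le (profile_succ_le_mul hm (by lia)))

lemma profile_succ_apply_le_mul (hm : 1 ≤ m) (hj : j ≤ n) :
    profile m n 1 s (j + 1) ≤ (m + 1) * profile m n 1 s j :=
  (succ_le_step (profile_nonneg zero_le_one s) hm hj).trans
    (profile_one_succ.symm.trans_le (profile_succ_le_mul hm (by lia)))

lemma profile_add_le_pow_mul (hm : 1 ≤ m) {d : ℕ} (hd : j + d ≤ n + 1) :
    profile m n 1 s (j + d) ≤ (m + 1) ^ d * profile m n 1 s j := by
  induction d with
  | zero => simp
  | succ d ih =>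
    calc profile m n 1 s (j + d + 1) ≤ (m + 1) * profile m n 1 s (j + d) :=
          profile_succ_apply_le_mul hm (by lia)
      _ ≤ (m + 1) * ((m + 1) ^ d * profile m n 1 s j) := by gcongr; exact ih (by lia)
      _ = (m + 1) ^ (d + 1) * profile m n 1 s j := by ring

lemma profile_end_le_pow_mul (hm : 1 ≤ m) (hj : j ≤ n + 1) :
    profile m n 1 s n ≤ (m + 1) ^ (n + 1) * profile m n 1 s j := by
  have hK : (1 : ℝ) ≤ m + 1 := le_add_of_nonneg_left m.cast_nonneg
  have hj0 := profile_nonneg (m := m) (n := n) zero_le_one s j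
  rcases hj.eq_or_lt with rfl | hlt
  · refine (profile_le_mul_succ hm le_rfl).trans (mul_le_mul_of_nonneg_right ?_ hj0)
    exact le_self_pow₀ hK n.succ_ne_zero
  · obtain ⟨d, rfl⟩ := Nat.exists_eq_add_of_le (Nat.lt_succ_iff.1 hlt)
    refine (profile_add_le_pow_mul hm (by lia)).trans (mul_le_mul_of_nonneg_right ?_ hj0)
    exact pow_le_pow_right₀ hK (by lia)

lemma profile_zero_le_mul_mono (hc : 0 ≤ c)
    (h : ∀ j ≤ n + 1, profile m n 0 s j ≤ c * profile m n 1 s j) {u : ℕ} (hu : s ≤ u)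
    (hj : j ≤ n + 1) : profile m n 0 u j ≤ c * profile m n 1 u j := by
  induction u, hu using Nat.le_induction generalizing j with
  | base => exact h j hj
  | succ u _ ih =>
    rcases j with _ | j
    · rw [profile_zero_zero_apply_zero]
      exact mul_nonneg hc (profile_nonneg zero_le_one _ _)
    · rw [profile_apply_succ, profile_apply_succ]
      exact step_le_mul (fun _ => ih) hj

-- The deficit caused by the missing middle vertex travels outwards by one vertex per step,
-- losing at most a factor `(m + 1) ^ 2` each time.
lemma profile_zero_le_one_sub_mul (hm : 1 ≤ m) (hc : 0 ≤ c)
    (h : ∀ j ≤ n + 1, profile m n 0 s j ≤ c * profile m n 1 s j) {u : ℕ} (hu : s + j ≤ u)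
    (hj : j ≤ n + 1) :
    profile m n 0 u j ≤ (1 - (((m : ℝ) + 1) ^ 2)⁻¹ ^ j) * (c * profile m n 1 u j) := by
  induction j generalizing u with
  | zero => simp [profile_zero_zero_apply_zero]
  | succ j ih =>
    obtain ⟨u, rfl⟩ : ∃ v, u = v + 1 := ⟨u - 1, by lia⟩
    set ε : ℝ := (((m : ℝ) + 1) ^ 2)⁻¹ with hε
    have hgap : ε * profile m n 1 (u + 1) (j + 1) ≤ profile m n 1 u j := by
      rw [hε, inv_mul_le_iff₀ (by positivity), sq, mul_assoc]
      refine (profile_succ_le_mul hm hj).trans ?_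
      gcongr
      exact profile_succ_apply_le_mul hm (by lia)
    have hstep := step_succ_add_le (m := m) (j := j)
      (fun i hi => profile_zero_le_mul_mono hc h (show s ≤ u by lia) hi) (by lia)
    rw [← profile_apply_succ, ← profile_apply_succ] at hstep
    have hpow : ε ^ j * c * (ε * profile m n 1 (u + 1) (j + 1)) ≤ ε ^ j * c * profile m n 1 u j :=
      mul_le_mul_of_nonneg_left hgap (by positivity)
    rw [pow_succ]
    linarith [ih (u := u) (by lia) (by lia)]

lemma profile_zero_le_pow_mul (hm : 1 ≤ m) (q : ℕ) (hj : j ≤ n + 1) :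
    profile m n 0 (q * (n + 1)) j ≤
      (1 - (((m : ℝ) + 1) ^ 2)⁻¹ ^ (n + 1)) ^ q * profile m n 1 (q * (n + 1)) j := by
  have hε : (((m : ℝ) + 1) ^ 2)⁻¹ ≤ 1 :=
    inv_le_one_of_one_le₀ (one_le_pow₀ (le_add_of_nonneg_left m.cast_nonneg))
  set ε : ℝ := (((m : ℝ) + 1) ^ 2)⁻¹
  have hρ : 0 ≤ 1 - ε ^ (n + 1) := sub_nonneg.2 (pow_le_one₀ (by positivity) hε)
  induction q generalizing j with
  | zero => rcases j with _ | j <;> simp [profile]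
  | succ q ih =>
    rw [pow_succ', mul_assoc]
    refine (profile_zero_le_one_sub_mul hm (pow_nonneg hρ q) (fun _ => ih) (by lia) hj).trans ?_
    refine mul_le_mul_of_nonneg_right ?_
      (mul_nonneg (pow_nonneg hρ q) (profile_nonneg zero_le_one _ _))
    exact sub_le_sub_left (pow_le_pow_of_le_one (by positivity) hε hj) 1

lemma exists_profile_zero_le_mul (hm : 1 ≤ m) (hc : 0 < c) :
    ∃ s₀, ∀ s ≥ s₀, ∀ j ≤ n + 1, profile m n 0 s j ≤ c * profile m n 1 s j := by
  obtain ⟨q, hq⟩ := exists_pow_lt_of_lt_one hc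
    (show 1 - (((m : ℝ) + 1) ^ 2)⁻¹ ^ (n + 1) < 1 from sub_lt_self 1 (by positivity))
  refine ⟨q * (n + 1), fun s hs j hj => profile_zero_le_mul_mono hc.le (fun i hi => ?_) hs hj⟩
  exact (profile_zero_le_pow_mul hm q hi).trans
    (mul_le_mul_of_nonneg_right hq.le (profile_nonneg zero_le_one _ _))

lemma profile_one_pos (hm : 1 ≤ m) (hj : j ≤ n + 1) : 0 < profile m n 1 s j := by
  induction s with
  | zero => simp only [profile_one_zero, one_pos]
  | succ s ih => linarith [two_mul_profile_le (s := s) hm hj]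

lemma exists_profile_zero_lt (hm : 1 ≤ m) :
    ∃ s₀, ∀ s ≥ s₀, ∀ i ≤ n + 2, ∀ j ≤ n + 2,
      profile m (n + 1) 0 s i < profile m (n + 1) 1 s j := by
  have hK : (0 : ℝ) < (m + 1) ^ (n + 2) := by positivity
  obtain ⟨s₀, hs₀⟩ := exists_profile_zero_le_mul (n := n + 1) hm (half_pos (inv_pos.2 hK))
  refine ⟨s₀, fun s hs i hi j hj => ?_⟩
  have hend : ((m + 1 : ℝ) ^ (n + 2))⁻¹ * profile m (n + 1) 1 s i ≤ profile m (n + 1) 1 s j := by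
    rw [inv_mul_le_iff₀ hK]
    exact (profile_le_end hm hi).trans (profile_end_le_pow_mul hm hj)
  linarith [hs₀ s hs i hi, profile_one_pos (s := s) hm hj]

end Domination

section Component

variable {m k n s : ℕ}

lemma mem_gammaVertices {c : ℕ} {i : ℤ} :
    (c, i) ∈ gammaVertices (m + 3) k n ↔
      c ≤ copies (m + 3) k ∧ -(n : ℤ) ≤ i ∧ i ≤ n + m ∧ (i = 0 → c = 0) := by
  simp [gammaVertices, and_assoc]

/-- The distance from the middle of a component of the vertex of index `i`, in the encoding of
`step`: all indices above `n` are sent to `n + 1`. -/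
def position (n : ℕ) (i : ℤ) : ℕ := min i.natAbs (n + 1)

lemma position_le (n : ℕ) (i : ℤ) : position n i ≤ n + 1 := min_le_right _ _

lemma position_of_lt {i : ℤ} (hi : n < i) : position n i = n + 1 := by
  rw [position]
  lia

lemma position_of_natAbs_le {i : ℤ} (hi : i.natAbs ≤ n) : position n i = i.natAbs := by
  rw [position]
  lia

lemma indexAdj_iff_of_lt {i j : ℤ} (hi : n < i) :
    indexAdj n i j ∧ j ≤ n + m ↔ j ∈ ({-(n : ℤ), (n : ℤ)} : Finset ℤ) := by
  simp only [indexAdj, Int.abs_eq_natAbs, Finset.mem_insert, Finset.mem_singleton]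
  lia

lemma indexAdj_iff_of_natAbs_lt {i j : ℤ} (hi : i.natAbs < n) :
    indexAdj n i j ∧ j ≤ n + m ↔ j ∈ ({i - 1, i + 1} : Finset ℤ) := by
  simp only [indexAdj, Int.abs_eq_natAbs, Finset.mem_insert, Finset.mem_singleton]
  lia

lemma indexAdj_end_iff (hn : 1 ≤ n) {σ j : ℤ} (hσ : σ = 1 ∨ σ = -1) :
    indexAdj n (σ * n) j ∧ j ≤ n + m ↔
      j ∈ insert (σ * (n - 1)) (Finset.Ioc (n : ℤ) (n + m)) := by
  simp only [indexAdj, Int.abs_eq_natAbs, Finset.mem_insert, Finset.mem_Ioc]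
  rcases hσ with rfl | rfl <;> lia

variable {p : gammaVertices (m + 3) k n} {F : gammaVertices (m + 3) k n → ℝ} {f : ℕ → ℝ}

lemma nbrSum_eq_sum {φ : ℤ → ℝ} {S : Finset ℤ}
    (hS : ∀ j, indexAdj n p.1.2 j ∧ j ≤ n + m ↔ j ∈ S) (hφ : p.1.1 ≠ 0 → φ 0 = 0)
    (hF : ∀ q, q.1.1 = p.1.1 → F q = φ q.1.2) :
    nbrSum (Gamma (m + 3) k n).Adj F p = ∑ j ∈ S, φ j := by
  classical
  have hp := (mem_gammaVertices.1 p.2).1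
  rw [← Finset.sum_filter_of_ne (p := fun j => (p.1.1, j) ∈ gammaVertices (m + 3) k n)]
  · refine Finset.sum_bij (fun q _ => q.1.2) ?_ ?_ ?_ ?_
    · intro q hq
      obtain ⟨hpq, hadj⟩ := (Finset.mem_filter.1 hq).2
      exact Finset.mem_filter.2
        ⟨(hS _).1 ⟨hadj, (mem_gammaVertices.1 q.2).2.2.1⟩, hpq ▸ q.2⟩
    · intro q hq q' hq' heq
      exact Subtype.ext (Prod.ext
        ((Finset.mem_filter.1 hq).2.1.symm.trans (Finset.mem_filter.1 hq').2.1) heq)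
    · intro j hj
      obtain ⟨hjS, hjG⟩ := Finset.mem_filter.1 hj
      exact ⟨⟨_, hjG⟩, Finset.mem_filter.2 ⟨Finset.mem_univ _, rfl, ((hS j).2 hjS).1⟩, rfl⟩
    · intro q hq
      exact hF q (Finset.mem_filter.1 hq).2.1.symm
  · intro j hj hne
    obtain ⟨hadj, hle⟩ := (hS j).2 hj
    have hge : -(n : ℤ) ≤ j := by
      simp only [indexAdj, Int.abs_eq_natAbs] at hadj
      lia
    exact mem_gammaVertices.2 ⟨hp, hge, hle, fun hj₀ => of_not_not fun h => hne (hj₀ ▸ hφ h)⟩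

lemma nbrSum_end (hn : 1 ≤ n) (hf : p.1.1 ≠ 0 → f 0 = 0)
    (hF : ∀ q, q.1.1 = p.1.1 → F q = f (position n q.1.2)) (hp : p.1.2.natAbs = n) :
    nbrSum (Gamma (m + 3) k n).Adj F p = f (n - 1) + m * f (n + 1) := by
  obtain ⟨σ, hσ, hpσ⟩ : ∃ σ : ℤ, (σ = 1 ∨ σ = -1) ∧ p.1.2 = σ * n := by
    rcases Int.natAbs_eq_iff.1 hp with h | h
    · exact ⟨1, .inl rfl, by lia⟩
    · exact ⟨-1, .inr rfl, by lia⟩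
  have hinner : (σ * ((n : ℤ) - 1)).natAbs = n - 1 := by rcases hσ with rfl | rfl <;> lia
  rw [nbrSum_eq_sum (φ := fun j => f (position n j)) (fun _ => hpσ ▸ indexAdj_end_iff hn hσ) hf hF,
    Finset.sum_insert (by rw [Finset.mem_Ioc]; lia), position_of_natAbs_le (by lia), hinner,
    Finset.sum_congr rfl fun j hj => by rw [position_of_lt (Finset.mem_Ioc.1 hj).1]]
  simp

lemma nbrSum_eq_step (hn : 1 ≤ n) (hf : p.1.1 ≠ 0 → f 0 = 0)
    (hF : ∀ q, q.1.1 = p.1.1 → F q = f (position n q.1.2)) :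
    nbrSum (Gamma (m + 3) k n).Adj F p = step m n f (position n p.1.2) := by
  have hsum := fun S hS => nbrSum_eq_sum (φ := fun j => f (position n j)) (S := S) hS hf hF
  rcases lt_trichotomy p.1.2.natAbs n with hlt | heq | hgt
  · rw [hsum _ fun _ => indexAdj_iff_of_natAbs_lt hlt, Finset.sum_pair (by lia), step,
      position_of_natAbs_le (by lia), position_of_natAbs_le (by lia),
      position_of_natAbs_le hlt.le, if_neg (show p.1.2.natAbs ≠ n + 1 by lia), if_neg hlt.ne]
    rcases lt_trichotomy p.1.2 0 with hneg | hzero | hpos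
    · rw [if_neg (by lia), show (p.1.2 - 1).natAbs = p.1.2.natAbs + 1 by lia,
        show (p.1.2 + 1).natAbs = p.1.2.natAbs - 1 by lia]
      ring
    · simp [hzero, two_mul]
    · rw [if_neg (by lia), show (p.1.2 - 1).natAbs = p.1.2.natAbs - 1 by lia,
        show (p.1.2 + 1).natAbs = p.1.2.natAbs + 1 by lia]
      ring
  · rw [nbrSum_end hn hf hF heq, position_of_natAbs_le heq.le, heq, step, if_neg (by lia),
      if_neg (by lia), if_pos rfl]
  · have hp : n < p.1.2 := by
      have := (mem_gammaVertices.1 p.2).2.1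
      lia
    rw [hsum _ fun _ => indexAdj_iff_of_lt hp, Finset.sum_pair (by lia), position_of_lt hp,
      position_of_natAbs_le (by lia), position_of_natAbs_le (by lia)]
    simp [step, two_mul]

lemma fst_eq_zero_of_position_eq_zero (hp : position n p.1.2 = 0) : p.1.1 = 0 :=
  (mem_gammaVertices.1 p.2).2.2.2 (by rw [position] at hp; lia)

lemma walks_eq_profile (hn : 1 ≤ n) (s : ℕ) (p : gammaVertices (m + 3) k n) :
    walks (Gamma (m + 3) k n).Adj s p =
      profile m n (if p.1.1 = 0 then 1 else 0) s (position n p.1.2) := by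
  induction s generalizing p with
  | zero =>
    rw [profile]
    split_ifs with hpos hp <;> simp_all [walks, fst_eq_zero_of_position_eq_zero]
  | succ s ih =>
    rw [walks_succ, nbrSum_eq_step (f := profile m n (if p.1.1 = 0 then 1 else 0) s) hn
      (fun hp => by rw [if_neg hp, profile_zero_zero_apply_zero]) (fun q hq => hq ▸ ih q), profile]
    split_ifs with hpos hp <;> simp_all [fst_eq_zero_of_position_eq_zero]

end Component

section Counting

variable {m h k n : ℕ}

lemma le_copies_mul (hm : 1 ≤ m) (k : ℕ) : k ≤ (copies (m + 3) k + 1) * m + 2 := by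
  have hm' : (0 : ℝ) < m := by exact_mod_cast hm
  have hceil : ((k : ℝ) - (m + 3 : ℕ) + 1) / ((m + 3 : ℕ) - 3) ≤ copies (m + 3) k :=
    Nat.le_ceil _
  push_cast at hceil
  rw [add_sub_cancel_right, div_le_iff₀ hm'] at hceil
  have : (k : ℝ) ≤ (copies (m + 3) k + 1) * m + 2 := by linarith
  exact_mod_cast this

lemma copies_add_one (hh : 4 ≤ h) (hk : h ≤ k) :
    copies h k + 1 = ⌈((k : ℝ) - 2) / ((h : ℝ) - 3)⌉₊ := by
  have hh' : (4 : ℝ) ≤ h := by exact_mod_cast hh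
  have hk' : (h : ℝ) ≤ k := by exact_mod_cast hk
  have hpos : (0 : ℝ) < (h : ℝ) - 3 := by linarith
  rw [copies, ← Nat.ceil_add_one (div_nonneg (by linarith) hpos.le), div_add_one hpos.ne']
  ring_nf

lemma card_gammaVertices (hh : 4 ≤ h) (hk : h ≤ k) :
    Fintype.card (gammaVertices h k n) = numVertices h k n := by
  have hunion : gammaVertices h k n = insert (0, 0) (Finset.range (copies h k + 1) ×ˢ
      (Finset.Icc (-(n : ℤ)) (n + (h - 3))).erase 0) := by
    ext ⟨c, i⟩
    simp only [gammaVertices, Finset.mem_insert, Prod.mk.injEq, Finset.mem_product,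
      Finset.mem_filter, Finset.mem_range, Finset.mem_erase, Finset.mem_Icc]
    lia
  rw [Fintype.card_coe, numVertices, ← copies_add_one hh hk, hunion,
    Finset.card_insert_of_notMem (by simp), Finset.card_product, Finset.card_range,
    Finset.card_erase_of_mem (by rw [Finset.mem_Icc]; lia), Int.card_Icc]
  congr 2
  lia

end Counting

section SlowConvergence

variable {m k n r s τ : ℕ}

lemma exists_notMem_top_of_ne_zero (hm : 1 ≤ m) (hk : k ≤ 2 * (n + 1) + m + 1) :
    ∃ s₀, ∀ s ≥ s₀, ∀ p : gammaVertices (m + 3) k (n + 1),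
      p.1.1 ≠ 0 → p ∉ top k (walks (Gamma (m + 3) k (n + 1)).Adj s) := by
  obtain ⟨s₀, hs₀⟩ := exists_profile_zero_lt (n := n) hm
  refine ⟨s₀, fun s hs p hp => notMem_top (T := {0} ×ˢ Finset.Icc (-(n + 1 : ℤ)) (n + 1 + m))
    (hk.trans_eq ?_) ?_⟩
  · rw [Finset.card_product, Finset.card_singleton, Int.card_Icc]
    lia
  · rintro ⟨c, i⟩ hi
    simp only [Finset.mem_product, Finset.mem_singleton, Finset.mem_Icc] at hi
    refine ⟨mem_gammaVertices.2 (by lia), ?_⟩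
    rw [walks_eq_profile (by lia), walks_eq_profile (by lia), if_neg hp, if_pos hi.1]
    exact hs₀ s hs _ (position_le _ _) _ (position_le _ _)

lemma profile_inner_lt {b : ℝ} {i j : ℕ} (hm : 3 ≤ m)
    (hs : (((s + 1) / 2 : ℕ) : ℝ) ≤ (m / 2) ^ (r + 1)) (hj : j < 2 * r + 3)
    (hi : b = 1 ∧ i = 2 * r + 3 ∨ (b = 0 ∨ b = 1) ∧ i = 2 * r + 3 + 1) :
    profile m (2 * r + 3) 1 (s + 2) j < profile m (2 * r + 3) b (s + 2) i := by
  have hpos : 0 < profile m (2 * r + 3) 1 (s + 1) (2 * r + 3) :=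
    profile_one_pos (by lia) (by lia)
  have hclose := profile_end_lt hm hs
  have hdouble : 2 * profile m (2 * r + 3) 1 (s + 1) (2 * r + 3) ≤
    profile m (2 * r + 3) 1 (s + 2) (2 * r + 3) := two_mul_profile_le (by lia) (by lia)
  have hinner := two_mul_profile_succ_le hm (show j ≤ 2 * r + 1 + 1 by lia)
    fun i hi => four_mul_profile_le (s := s) hm hi
  rcases hi with ⟨rfl, rfl⟩ | ⟨rfl | rfl, rfl⟩
  · linarith
  · rw [profile_succ_top]
    linarith
  · rw [profile_succ_top]
    linarith

lemma notMem_top_of_natAbs_lt (hm : 3 ≤ m) (hs : (((s + 1) / 2 : ℕ) : ℝ) ≤ (m / 2) ^ (r + 1))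
    {p : gammaVertices (m + 3) k (2 * r + 3)} (hp₀ : p.1.1 = 0) (hp : p.1.2.natAbs < 2 * r + 3) :
    p ∉ top k (walks (Gamma (m + 3) k (2 * r + 3)).Adj (s + 2)) := by
  set n := 2 * r + 3
  refine notMem_top (T := {0} ×ˢ {-(n : ℤ), (n : ℤ)} ∪
    Finset.range (copies (m + 3) k + 1) ×ˢ Finset.Ioc (n : ℤ) (n + m)) ?_ ?_
  · rw [Finset.card_union_of_disjoint, Finset.card_product, Finset.card_product,
      Finset.card_pair (by lia), Finset.card_range, Int.card_Ioc]
    · have := le_copies_mul (show 1 ≤ m by lia) k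
      simp only [Finset.card_singleton, add_sub_cancel_left, Int.toNat_natCast]
      lia
    · exact Finset.disjoint_product.2 (.inr (by simp))
  · rintro ⟨c, i⟩ hi
    simp only [Finset.mem_union, Finset.mem_product, Finset.mem_singleton, Finset.mem_insert,
      Finset.mem_range, Finset.mem_Ioc] at hi
    refine ⟨mem_gammaVertices.2 (by lia), ?_⟩
    rw [walks_eq_profile (by lia), walks_eq_profile (by lia), if_pos hp₀,
      position_of_natAbs_le hp.le]
    refine profile_inner_lt hm hs hp ?_
    rcases hi with ⟨rfl, hi⟩ | ⟨-, hi, -⟩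
    · exact .inl ⟨if_pos rfl, by rw [position_of_natAbs_le] <;> lia⟩
    · exact .inr ⟨(ite_eq_or_eq _ _ _).symm, position_of_lt hi⟩

lemma not_convergesIn_of_eq_smul_walks (hm : 3 ≤ m) (hk : k ≤ 2 * (2 * r + 3) + m + 1)
    (hτ : (τ : ℝ) ≤ (m / 2) ^ (r + 1)) {x : ℕ → gammaVertices (m + 3) k (2 * r + 3) → ℝ}
    {u : ℕ → ℕ} (hu : ∀ t, t ≤ u t ∧ u t ≤ 2 * t)
    (hx : ∀ t, ∃ c : ℝ, 0 < c ∧ x t = c • walks (Gamma (m + 3) k (2 * r + 3)).Adj (u t)) :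
    ¬ ConvergesIn x (m + 3) k τ := by
  have htop (t) : top k (x t) = top k (walks (Gamma (m + 3) k (2 * r + 3)).Adj (u t)) := by
    obtain ⟨c, hc, h⟩ := hx t
    rw [h, top_smul hc]
  have hmax : ((max τ 1 : ℕ) : ℝ) ≤ (m / 2) ^ (r + 1) := by
    have hm' : (3 : ℝ) ≤ m := by exact_mod_cast hm
    rw [Nat.cast_max, Nat.cast_one]
    exact max_le hτ (one_le_pow₀ (by linarith))
  obtain ⟨s₀, hs₀⟩ := exists_notMem_top_of_ne_zero (m := m) (by lia) hk
  have hsub : ∀ p ∈ ⋂ t ≥ τ, top k (x t), p.1 ∈ ({0} : Finset ℕ) ×ˢ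
      insert (-(2 * r + 3 : ℤ)) (Finset.Icc (2 * r + 3 : ℤ) (2 * r + 3 + m)) := by
    intro p hp
    simp only [Set.mem_iInter, htop] at hp
    have hzero : p.1.1 = 0 := by
      by_contra hne
      exact hs₀ _ ((le_max_right τ s₀).trans (hu _).1) p hne (hp _ (le_max_left _ _))
    have hend : ¬ p.1.2.natAbs < 2 * r + 3 := by
      intro hlt
      have hu₂ := hu (max τ 2)
      obtain ⟨s, hs⟩ : ∃ s, u (max τ 2) = s + 2 := ⟨u (max τ 2) - 2, by lia⟩
      have hsτ : (s + 1) / 2 ≤ max τ 1 := by lia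
      exact notMem_top_of_natAbs_lt hm ((Nat.cast_le.2 hsτ).trans hmax) hzero hlt
        (hs ▸ hp _ (le_max_left τ 2))
    have := mem_gammaVertices.1 p.2
    simp only [Finset.mem_product, Finset.mem_singleton, Finset.mem_insert, Finset.mem_Icc]
    lia
  refine not_le.2 ((ncard_le_card_of_forall_mem hsub).trans_lt ?_)
  rw [Finset.card_product, Finset.card_singleton,
    Finset.card_insert_of_notMem (by rw [Finset.mem_Icc]; lia), Int.card_Icc]
  lia

lemma tBar_le_pow : tBar (m + 3) (2 * r + 3) ≤ (m / 2) ^ (r + 1) := by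
  have hlog : Real.log (7 / 6) ≤ 7 / 6 - 1 := Real.log_le_sub_one_of_pos (by norm_num)
  have hconst : 3 * Real.log (7 / 6) / (4 * Real.exp 1) ≤ 1 := by
    rw [div_le_one (by positivity)]
    linarith [Real.exp_one_gt_d9]
  calc
    tBar (m + 3) (2 * r + 3)
      = 3 * Real.log (7 / 6) / (4 * Real.exp 1) * (m / 2) ^ (r + 1) := by
        rw [tBar, ← Real.rpow_natCast]
        push_cast
        ring_nf
    _ ≤ (m / 2) ^ (r + 1) := mul_le_of_le_one_left (by positivity) hconst

lemma Admissible.exists_eq {h k n : ℕ} (hA : Admissible h k n) :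
    ∃ m r, h = m + 3 ∧ n = 2 * r + 3 ∧ 3 ≤ m ∧ k ≤ 2 * n + m + 1 := by
  obtain ⟨hh, -, ⟨r, rfl⟩, hmax⟩ := hA
  have hn : 3 ≤ 2 * r + 1 := by exact_mod_cast (le_max_left _ _).trans hmax
  have hk : ((k + 2 : ℕ) : ℝ) ≤ (2 * (2 * r + 1) + h : ℕ) := by
    have := (le_max_right _ _).trans hmax
    push_cast at this ⊢
    linarith
  have hk' : k + 2 ≤ 2 * (2 * r + 1) + h := by exact_mod_cast hk
  exact ⟨h - 3, r - 1, by lia, by lia, by lia, by lia⟩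

theorem Admissible.not_convergesIn {h k n : ℕ} (hA : Admissible h k n)
    (hτ : (τ : ℝ) ≤ tBar h n) :
    ¬ ConvergesIn (authority (Gamma h k n).Adj) h k τ ∧
    ¬ ConvergesIn (hub (Gamma h k n).Adj) h k τ ∧
    ¬ ConvergesIn (halfSteps (Gamma h k n).Adj) h k τ := by
  obtain ⟨m, r, rfl, rfl, hm, hk⟩ := hA.exists_eq
  have hslow := @not_convergesIn_of_eq_smul_walks m k r τ hm hk (hτ.trans tBar_le_pow)
  have := (Gamma (m + 3) k (2 * r + 3)).symm
  exact ⟨hslow (fun t => by lia) exists_authority_eq_smul_walks,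
    hslow (fun t => by lia) exists_hub_eq_smul_walks,
    hslow (fun t => by lia) exists_halfSteps_eq_smul_walks⟩

end SlowConvergence

section Growth

variable {h k n : ℕ}

lemma six_rpow_neg_two_le : (6 : ℝ) ^ (-2 : ℝ) ≤ 3 * Real.log (7 / 6) / (4 * Real.exp 1) := by
  have hlog : 1 - (7 / 6 : ℝ)⁻¹ ≤ Real.log (7 / 6) := Real.one_sub_inv_le_log_of_pos (by norm_num)
  have hexp := Real.exp_one_lt_d9
  rw [Real.rpow_neg (by norm_num), le_div_iff₀ (by positivity)]
  norm_num at hlog ⊢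
  linarith

lemma rpow_one_div_five_le (hh : 6 ≤ h) : (h : ℝ) ^ (1 / 5 : ℝ) ≤ ((h : ℝ) - 3) / 2 := by
  have hh' : (6 : ℝ) ≤ h := by exact_mod_cast hh
  have hpow : (h : ℝ) ≤ (h / 4) ^ 5 := by
    have : (6 : ℝ) ^ 4 ≤ (h : ℝ) ^ 4 := by gcongr
    nlinarith
  calc
    (h : ℝ) ^ (1 / 5 : ℝ) ≤ ((h / 4) ^ (5 : ℕ)) ^ (1 / 5 : ℝ) := by gcongr
    _ = h / 4 := by
      rw [← Real.rpow_natCast, ← Real.rpow_mul (by positivity)]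
      norm_num
    _ ≤ (h - 3) / 2 := by linarith

lemma rpow_le_tBar (hh : 6 ≤ h) (hn : 1 ≤ n) :
    (h : ℝ) ^ (((n : ℝ) - 1) / 10 - 2) ≤ tBar h n := by
  have hh' : (6 : ℝ) ≤ h := by exact_mod_cast hh
  have hn' : (1 : ℝ) ≤ n := by exact_mod_cast hn
  have hconst : (h : ℝ) ^ (-2 : ℝ) ≤ 3 * Real.log (7 / 6) / (4 * Real.exp 1) :=
    (Real.rpow_le_rpow_of_nonpos (by norm_num) hh' (by norm_num)).trans six_rpow_neg_two_le
  calc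
    (h : ℝ) ^ (((n : ℝ) - 1) / 10 - 2)
      = h ^ (-2 : ℝ) * ((h : ℝ) ^ (1 / 5 : ℝ)) ^ (((n : ℝ) - 1) / 2) := by
        rw [← Real.rpow_mul (by positivity), ← Real.rpow_add (by positivity)]
        ring_nf
    _ ≤ tBar h n := by
        rw [tBar]
        gcongr
        exact rpow_one_div_five_le hh

lemma rpow_le_tBar_of_le {K x : ℝ} (hK : 0 < K) (hh : 6 ≤ h) (hn : 42 ≤ n) (hx : x ≤ K * n) :
    (h : ℝ) ^ (1 / (20 * K) * x) ≤ tBar h n := by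
  have hh' : (1 : ℝ) ≤ h := by exact_mod_cast (by lia : 1 ≤ h)
  have hn' : (42 : ℝ) ≤ n := by exact_mod_cast hn
  refine (Real.rpow_le_rpow_of_exponent_le hh' ?_).trans (rpow_le_tBar hh (by lia))
  calc
    1 / (20 * K) * x ≤ 1 / (20 * K) * (K * n) := by gcongr
    _ = n / 20 := by field_simp
    _ ≤ (n - 1) / 10 - 2 := by linarith

lemma ceil_mul_le (hh : 6 ≤ h) (hk : h ≤ k) :
    (⌈((k : ℝ) - 2) / ((h : ℝ) - 3)⌉₊ : ℝ) * h ≤ 4 * k := by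
  have hh' : (6 : ℝ) ≤ h := by exact_mod_cast hh
  have hk' : (h : ℝ) ≤ k := by exact_mod_cast hk
  have hpos : (0 : ℝ) < (h : ℝ) - 3 := by linarith
  have hceil := Nat.ceil_lt_add_one (div_nonneg (show (0 : ℝ) ≤ k - 2 by linarith) hpos.le)
  rw [div_add_one hpos.ne', lt_div_iff₀ hpos] at hceil
  have : (0 : ℝ) ≤ (⌈((k : ℝ) - 2) / ((h : ℝ) - 3)⌉₊ : ℝ) * (h - 6) := by
    have := sub_nonneg.2 hh'
    positivity
  linarith

lemma numVertices_mul_div_le (hh : 6 ≤ h) (hk : h ≤ k) :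
    (numVertices h k n : ℝ) * h / k ≤ 8 * n + 4 * h := by
  have hh' : (6 : ℝ) ≤ h := by exact_mod_cast hh
  have hk' : (h : ℝ) ≤ k := by exact_mod_cast hk
  have hsub : ((2 * n + h - 3 : ℕ) : ℝ) = 2 * n + h - 3 := by
    rw [Nat.cast_sub (by lia)]
    push_cast
    ring
  have hceil := mul_le_mul_of_nonneg_right (ceil_mul_le hh hk)
    (show (0 : ℝ) ≤ 2 * n + h - 3 by linarith)
  rw [div_le_iff₀ (by linarith), numVertices]
  push_cast [hsub]
  linarith

lemma numVertices_mono (h k : ℕ) : Monotone (numVertices h k) := by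
  intro n n' hn
  rw [numVertices, numVertices]
  gcongr

lemma numVertices_le_of_lt (hh : 6 ≤ h) (hk : k + 4 ≤ 2 * h) :
    numVertices h k n ≤ 4 * n + 2 * h := by
  have hh' : (6 : ℝ) ≤ h := by exact_mod_cast hh
  have hk' : (k : ℝ) + 4 ≤ 2 * h := by exact_mod_cast hk
  have hceil : ⌈((k : ℝ) - 2) / ((h : ℝ) - 3)⌉₊ ≤ 2 := by
    rw [Nat.ceil_le, div_le_iff₀ (by linarith)]
    push_cast
    linarith
  calc
    numVertices h k n ≤ 2 * (2 * n + h - 3) + 1 := by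
      rw [numVertices]
      gcongr
    _ ≤ 4 * n + 2 * h := by lia

lemma Admissible.min_mul_le (hA : Admissible h k n) {ε : ℝ} (hε : 0 < ε)
    (hgap : (1 + ε) * h ≤ k ∨ (2 + ε) * k ≤ numVertices h k n) :
    min ε (1 / 2) * h ≤ 4 * n := by
  obtain ⟨hh, hk, -, hmax⟩ := hA
  have hk' : (h : ℝ) < k := by exact_mod_cast hk
  have hn : (3 : ℝ) ≤ n := (le_max_left _ _).trans hmax
  have hkn := (le_max_right _ _).trans hmax
  have hleft := mul_le_mul_of_nonneg_right (min_le_left ε (1 / 2)) h.cast_nonneg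
  have hright := mul_le_mul_of_nonneg_right (min_le_right ε (1 / 2)) h.cast_nonneg
  rcases hgap with hgap | hgap
  · linarith
  rcases le_or_gt (2 * h) (k + 3) with hlarge | hsmall
  · have hlarge' : 2 * (h : ℝ) ≤ k + 3 := by exact_mod_cast hlarge
    linarith
  · have hN : (numVertices h k n : ℝ) ≤ 4 * n + 2 * h := by
      exact_mod_cast numVertices_le_of_lt hh (by lia)
    have := mul_le_mul_of_nonneg_left hk'.le hε.le
    linarith

theorem exists_numVertices_rpow_le_tBar (h k : ℕ) :
    ∃ N₀ : ℕ, ∀ n, Admissible h k n → N₀ ≤ numVertices h k n →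
      (h : ℝ) ^ (1 / (20 * 12) * (numVertices h k n * h / k : ℝ)) ≤ tBar h n := by
  refine ⟨numVertices h k (max 42 h) + 1, fun n hA hN => ?_⟩
  have hn : max 42 h < n := (numVertices_mono h k).reflect_lt hN
  refine rpow_le_tBar_of_le (by norm_num) hA.1 (by lia) ?_
  have hhn : (h : ℝ) ≤ n := by exact_mod_cast (by lia : h ≤ n)
  linarith [numVertices_mul_div_le (n := n) hA.1 hA.2.1.le]

theorem Admissible.numVertices_rpow_le_tBar (hA : Admissible h k n) {ε : ℝ} (hε : 0 < ε)
    (hn : 42 ≤ n) (hgap : (1 + ε) * h ≤ k ∨ (2 + ε) * k ≤ numVertices h k n) :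
    (h : ℝ) ^ (1 / (20 * (8 + 16 / min ε (1 / 2))) * (numVertices h k n * h / k)) ≤ tBar h n := by
  have hδ : 0 < min ε (1 / 2) := lt_min hε (by norm_num)
  refine rpow_le_tBar_of_le (by positivity) hA.1 hn ?_
  have hh : (h : ℝ) ≤ 4 * n / min ε (1 / 2) := by
    rw [le_div_iff₀ hδ, mul_comm]
    exact hA.min_mul_le hε hgap
  calc
    numVertices h k n * h / k ≤ (8 * n + 4 * h : ℝ) := numVertices_mul_div_le hA.1 hA.2.1.le
    _ ≤ 8 * n + 4 * (4 * n / min ε (1 / 2)) := by gcongr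
    _ = (8 + 16 / min ε (1 / 2)) * n := by ring

end Growth

end HITS

theorem theorem1 :
    (∀ h k n : ℕ, HITS.Admissible h k n →
      Fintype.card (HITS.gammaVertices h k n) = HITS.numVertices h k n ∧
      ∀ τ : ℕ, (τ : ℝ) ≤ HITS.tBar h n →
        ¬ HITS.ConvergesIn (HITS.authority (HITS.Gamma h k n).Adj) h k τ ∧
        ¬ HITS.ConvergesIn (HITS.hub (HITS.Gamma h k n).Adj) h k τ ∧
        ¬ HITS.ConvergesIn (HITS.halfSteps (HITS.Gamma h k n).Adj) h k τ) ∧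
    (∃ c : ℝ, 0 < c ∧ ∃ n₀ : ℕ, ∀ h k n : ℕ, HITS.Admissible h k n → n₀ ≤ n →
      (h : ℝ) ^ (c * n) ≤ HITS.tBar h n) ∧
    (∃ c : ℝ, 0 < c ∧ ∀ h k : ℕ, ∃ N₀ : ℕ, ∀ n : ℕ, HITS.Admissible h k n →
      2 * k ≤ HITS.numVertices h k n → N₀ ≤ HITS.numVertices h k n →
      (h : ℝ) ^ (c * (HITS.numVertices h k n * h / k)) ≤ HITS.tBar h n) ∧
    (∀ ε : ℝ, 0 < ε → ∃ c : ℝ, 0 < c ∧ ∃ n₀ : ℕ, ∀ h k n : ℕ, HITS.Admissible h k n → n₀ ≤ n →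
      2 * k ≤ HITS.numVertices h k n →
      ((1 + ε) * h ≤ k ∨ (2 + ε) * k ≤ HITS.numVertices h k n) →
      (h : ℝ) ^ (c * (HITS.numVertices h k n * h / k)) ≤ HITS.tBar h n) := by
  refine ⟨fun h k n hA => ⟨HITS.card_gammaVertices ?_ hA.2.1.le, fun τ => hA.not_convergesIn⟩,
    ⟨1 / (20 * 1), by norm_num, 42, fun h k n hA hn => ?_⟩,
    ⟨1 / (20 * 12), by norm_num, fun h k => ?_⟩, fun ε hε => ?_⟩
  · have := hA.1
    lia
  · exact HITS.rpow_le_tBar_of_le one_pos hA.1 hn (by rw [one_mul])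
  · obtain ⟨N₀, hN₀⟩ := HITS.exists_numVertices_rpow_le_tBar h k
    exact ⟨N₀, fun n hA _ => hN₀ n hA⟩
  · exact ⟨1 / (20 * (8 + 16 / min ε (1 / 2))), by positivity, 42,
      fun h k n hA hn _ => hA.numVertices_rpow_le_tBar hε hn⟩
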